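/- **Setting.** Let $(Y_i,X_i)_{i\in\mathbb Z}$ be a process with $Y_i$ real and $X_i\in\mathbb R^d$, and let $Z_i=(Y_{i-1},\dots,Y_{i-s},X_i,\dots,X_{i-q})$. Given real functions $T,V$ and a density $f$, say that the process follows the model $(T,V)$ under a probability law if it is stationary and ergodic with finite second moments and $$Y_i=T(Z_i)+V(Z_i)\,\epsilon_i,\qquad i\in\mathbb Z,$$ where the $\epsilon_i$ are i.i.d., centered, with unit variance and density $f$, and each $\epsilon_i$ is independent of $\sigma(Z_j,\ j\le i)$. Let $\{(m(\rho,\cdot),\sigma(\theta,\cdot)):\rho\in\Theta_1\subset\mathbb R^\ell,\ \theta\in\Theta_2\subset\mathbb R^p\}$ be a parametric family with $\sigma>0$, where $\Theta_1,\Theta_2$ have non-empty interior, let $\phi_0=(\rho_0,\theta_0)\in\Theta_1\times\Theta_2$, and let $G,S$ be given functions. Under $H_0$ (law $P_0$) the process follows the model $(m(\rho_0,\cdot),\sigma(\theta_0,\cdot))$; under $H_1^{(n)}$ (law $P_{1,n}$) it follows the model $(m(\rho_0,\cdot)+n^{-1/2}G,\ \sigma(\theta_0,\cdot)+n^{-1/2}S)$.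 For each $n\ge 1$ one observes a sample $W_n$, a measurable function of the process (for instance $W_n=(Y_1,\dots,Y_n)$), with densities $f_{n,0}$ under $H_0$ and $f_n$ under $H_1^{(n)}$ with respect to a common measure. Put $\Lambda_n=\log\big(f_n(W_n)/f_{n,0}(W_n)\big)$. All estimates, tests and central sequences are functions of $W_n$. The symbols $o_P(1)$, $O_P(1)$ and convergence in probability in the hypotheses refer to $P_0$. **Hypotheses.** - (LAN) There are a function $\tau$ of the parameter, continuous at $\phi_0$ with $\tau(\phi_0)>0$, and central sequences $\mathcal V_n(\phi)$, such that under $H_0$, $\mathcal V_n(\phi_0)$ converges in distribution to $\mathcal N(0,\tau^2(\phi_0))$ and $\Lambda_n=\mathcal V_n(\phi_0)-\tau^2(\phi_0)/2+o_P(1)$. - (E.1) There are an estimate $\hat\phi_n$ with $\sqrt n(\hat\phi_n-\phi_0)=O_P(1)$ and random variables $D_n$ bounded in probability (in particular, uniformly bounded $D_n$ are allowed), such that $\mathcal V_n(\hat\phi_n)=\mathcal V_n(\phi_0)-D_n+o_P(1)$. - (Gradient condition and (C.1), respectively (C.2)) For each $n$ a component $\phi_{\kappa_n}$ of $\phi=(\rho,\theta)$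 is chosen: a component of $\rho$ in case (C.1), of $\theta$ in case (C.2). Almost surely $\mathcal V_n$ is differentiable at $\hat\phi_n$ with $\partial\mathcal V_n(\hat\phi_n)/\partial\phi_{\kappa_n}\neq0$, and $n^{-1/2}\,\partial\mathcal V_n(\hat\phi_n)/\partial\phi_{\kappa_n}\to c$ in probability for a constant $c\ne0$. - (Modified estimate) $\bar\phi_n$ is obtained from $\hat\phi_n$ by adding $D_n\big/\frac{\partial\mathcal V_n(\hat\phi_n)}{\partial\phi_{\kappa_n}}$ to the $\kappa_n$-th component, and it lies on the tangent space of $\mathcal V_n$ at $\hat\phi_n$ up to a negligible term: $$\mathcal V_n(\bar\phi_n)-\mathcal V_n(\hat\phi_n)=\partial\mathcal V_n(\hat\phi_n)'(\bar\phi_n-\hat\phi_n)+o_P(1).$$ **Theorem 1.** Let $0<\alpha<1$, let $\Phi$ be the standard normal distribution function, $Z(\alpha)$ its $(1-\alpha)$-quantile, $\bar\tau=\tau(\bar\phi_n)$, and let $\bar T_n=I\{\mathcal V_n(\bar\phi_n)/\bar\tau\ge Z(\alpha)\}$ be the Neyman–Pearson-type test in which $\phi_0$ is replaced by $\bar\phi_n$.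 Under the hypotheses above, the asymptotic power of $\bar T_n$ under $H_1^{(n)}$ is $1-\Phi(Z(\alpha)-\bar\tau)$. Precisely, $$P_{1,n}(\bar T_n=1)\to 1-\Phi\big(Z(\alpha)-\tau(\phi_0)\big),$$ and the difference $P_{1,n}(\bar T_n=1)-\big[1-\Phi(Z(\alpha)-\tau(\bar\phi_n))\big]$ tends to $0$ in probability under $H_1^{(n)}$. Moreover $\bar T_n$ is asymptotically optimal: $P_0(\bar T_n=1)\to\alpha$, and for every sequence of (possibly randomized) tests $\psi_n$ based on $W_n$ with $\limsup_n E_{P_0}\psi_n\le\alpha$ one has $\limsup_n\big(E_{P_{1,n}}\psi_n-P_{1,n}(\bar T_n=1)\big)\le0$. -/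

import Mathlib

open MeasureTheory ProbabilityTheory Filter Topology

noncomputable section

/-- The parameter space `ℝ^ℓ × ℝ^p` with its Euclidean norm. The coordinates `Sum.inl j` are those
of `ρ`, the coordinates `Sum.inr k` are those of `θ`. -/
abbrev Param (ℓ p : ℕ) : Type := EuclideanSpace ℝ (Fin ℓ ⊕ Fin p)

/-- The parameter `(ρ', θ')'` with first block `ρ` and second block `θ`. -/
def joinParam {ℓ p : ℕ} (ρ : EuclideanSpace ℝ (Fin ℓ)) (θ : EuclideanSpace ℝ (Fin p)) :
    Param ℓ p :=
  WithLp.toLp 2 (Sum.elim (fun j => ρ j) (fun k => θ k))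

/-! ### The stochastic model `Y_i = T(Z_i) + V(Z_i) ε_i` -/

/-- Trajectories `(Y_i, X_i)_{i ∈ ℤ}`, with `Y_i` real and `X_i` a `d`-variate vector. -/
abbrev Trajectory (d : ℕ) : Type := ℤ → ℝ × (Fin d → ℝ)

/-- The range of `Z_i = (Y_{i-1}, …, Y_{i-s}, X_i, X_{i-1}, …, X_{i-q})`. -/
abbrev Regressor (d s q : ℕ) : Type := (Fin s → ℝ) × (Fin (q + 1) → Fin d → ℝ)

/-- The time shift on trajectories. -/
def pathShift (d : ℕ) (x : Trajectory d) : Trajectory d := fun i => x (i + 1)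

/-- The trajectory of the process `(Y_i, X_i)_{i ∈ ℤ}`. -/
def pathOf {Ω : Type*} {d : ℕ} (Y : ℤ → Ω → ℝ) (X : ℤ → Ω → Fin d → ℝ) (ω : Ω) : Trajectory d :=
  fun i => (Y i ω, X i ω)

/-- `Z_i = (Y_{i-1}, …, Y_{i-s}, X_i, X_{i-1}, …, X_{i-q})`. -/
def regressor {Ω : Type*} {d : ℕ} (s q : ℕ) (Y : ℤ → Ω → ℝ) (X : ℤ → Ω → Fin d → ℝ) (i : ℤ)
    (ω : Ω) : Regressor d s q :=
  (fun a => Y (i - 1 - (a : ℕ)) ω, fun b => X (i - (b : ℕ)) ω)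

/-- The past `ℱ_i = σ(Z_j, j ≤ i)`. -/
abbrev pastSigma {Ω : Type*} {d : ℕ} (s q : ℕ) (Y : ℤ → Ω → ℝ) (X : ℤ → Ω → Fin d → ℝ) (i : ℤ) :
    MeasurableSpace Ω :=
  ⨆ j : {j : ℤ // j ≤ i}, MeasurableSpace.comap (regressor s q Y X j) inferInstance

/-- Under `P`, the process `(Y_i, X_i)` is stationary and ergodic with finite second moments, and
satisfies `Y_i = T(Z_i) + V(Z_i) ε_i` for some centered i.i.d. `ε_i` with unit variance and
density `f`, where each `ε_i` is independent of `σ(Z_j, j ≤ i)`. -/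
structure FollowsModel {Ω : Type*} [MeasurableSpace Ω] {d : ℕ} (s q : ℕ)
    (Y : ℤ → Ω → ℝ) (X : ℤ → Ω → Fin d → ℝ) (f : ℝ → ℝ) (T V : Regressor d s q → ℝ)
    (P : Measure Ω) : Prop where
  ergodic : Ergodic (pathShift d) (P.map (pathOf Y X))
  memLp_Y : ∀ i, MemLp (Y i) 2 P
  memLp_X : ∀ i, MemLp (X i) 2 P
  exists_noise : ∃ ε : ℤ → Ω → ℝ,
    (∀ i, Measurable (ε i)) ∧
    iIndepFun ε P ∧
    (∀ i, P.map (ε i) = volume.withDensity (fun x => ENNReal.ofReal (f x))) ∧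
    (∀ i, MemLp (ε i) 2 P ∧ P[ε i] = 0 ∧ Var[ε i; P] = 1) ∧
    (∀ i, Indep (pastSigma s q Y X i) (MeasurableSpace.comap (ε i) inferInstance) P) ∧
    (∀ i, ∀ᵐ ω ∂P, Y i ω = T (regressor s q Y X i ω) + V (regressor s q Y X i ω) * ε i ω)

/-! ### Stochastic orders -/

/-- `U_n = o_P(1)`. -/
def IsLittleOP {Ω : Type*} [MeasurableSpace Ω] (P : Measure Ω) (U : ℕ → Ω → ℝ) : Prop :=
  TendstoInMeasure P U atTop (fun _ => 0)

/-- `U_n = O_P(1)`. -/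
def IsBigOP {Ω E : Type*} [MeasurableSpace Ω] [NormedAddCommGroup E] (P : Measure Ω)
    (U : ℕ → Ω → E) : Prop :=
  ∀ δ : ℝ, 0 < δ → ∃ M : ℝ, ∀ᶠ n in atTop, P {ω | M < ‖U n ω‖} ≤ ENNReal.ofReal δ

/-- `φhat` is a `√n`-consistent estimate of `φ₀`: `√n (φhat_n - φ₀) = O_P(1)`. -/
def IsSqrtConsistent {Ω : Type*} [MeasurableSpace Ω] {ℓ p : ℕ} (P : Measure Ω)
    (φhat : ℕ → Ω → Param ℓ p) (φ₀ : Param ℓ p) : Prop :=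
  IsBigOP P (fun n ω => Real.sqrt n • (φhat n ω - φ₀))

/-- The random variable `w` has density `g` with respect to `μ` under `P`. -/
def HasDensity {Ω 𝒲 : Type*} [MeasurableSpace Ω] [MeasurableSpace 𝒲] (P : Measure Ω)
    (w : Ω → 𝒲) (μ : Measure 𝒲) (g : 𝒲 → ℝ) : Prop :=
  Measurable g ∧ (∀ x, 0 ≤ g x) ∧ P.map w = μ.withDensity (fun x => ENNReal.ofReal (g x))

/-- Local asymptotic normality under the null law `P` with central sequence `Vn` and variance `τ²`:
`Vn` converges in law to `N(0, τ²)` with `τ > 0`, and the log-likelihood ratio `Λ` satisfies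
`Λ_n = Vn - τ² / 2 + o_P(1)`. -/
structure LAN {Ω : Type*} [MeasurableSpace Ω] (P : Measure Ω) [IsProbabilityMeasure P]
    (Λ Vn : ℕ → Ω → ℝ) (τ : ℝ) : Prop where
  pos : 0 < τ
  clt : TendstoInDistribution Vn atTop (id : ℝ → ℝ) (fun _ => P)
    (gaussianReal 0 (Real.toNNReal (τ ^ 2)))
  expansion : IsLittleOP P (fun n ω => Λ n ω - (Vn n ω - τ ^ 2 / 2))

/-! ### The modified estimate and the tests -/

/-- The partial derivative of `F` at `φ` in the direction of the coordinate `κ`. -/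
def partialAt {ℓ p : ℕ} (F : Param ℓ p → ℝ) (φ : Param ℓ p) (κ : Fin ℓ ⊕ Fin p) : ℝ :=
  fderiv ℝ F φ (EuclideanSpace.single κ 1)

/-- The modified estimate: the coordinate `κ` of the estimate `φ` is increased by `D / ∂_κ F(φ)`,
so that `∂F(φ) · (modifiedEstimate - φ) = D` as soon as `∂_κ F(φ) ≠ 0`. -/
def modifiedEstimate {ℓ p : ℕ} (F : Param ℓ p → ℝ) (φ : Param ℓ p) (κ : Fin ℓ ⊕ Fin p) (D : ℝ) :
    Param ℓ p :=
  φ + EuclideanSpace.single κ (D / partialAt F φ κ)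

/-- The defect of a point `ψ` from lying on the tangent space of `F` at `φ`, that is, on the set of
the `ψ` with `F ψ - F φ = ∂F(φ) · (ψ - φ)`. -/
def tangentDefect {ℓ p : ℕ} (F : Param ℓ p → ℝ) (φ ψ : Param ℓ p) : ℝ :=
  F ψ - F φ - fderiv ℝ F φ (ψ - φ)

/-- The standard normal distribution function `Φ`. -/
def stdNormalCDF (x : ℝ) : ℝ := cdf (gaussianReal 0 1) x

/-- `Z(α)`, the `(1 - α)`-quantile of the standard normal distribution. -/
def normalQuantile (α : ℝ) : ℝ := sInf {x : ℝ | 1 - α ≤ stdNormalCDF x}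

/-- The Neyman-Pearson-type test `I{v / t ≥ Z(α)}`, with value `1` when it rejects. -/
def npTest (α v t : ℝ) : ℝ :=
  Set.indicator {x : ℝ | normalQuantile α ≤ x} (fun _ => 1) (v / t)

/-- A test based on the sample: a measurable function with values in `[0, 1]`, the probability of
rejection given the sample. -/
def IsTest {𝒲 : Type*} [MeasurableSpace 𝒲] (ψ : 𝒲 → ℝ) : Prop :=
  Measurable ψ ∧ ∀ w, ψ w ∈ Set.Icc (0 : ℝ) 1

/-- The rejection probability, under `P`, of the test `ψ` based on the sample `W`. -/
def rejectionProb {Ω 𝒲 : Type*} [MeasurableSpace Ω] (P : Measure Ω) (W : Ω → 𝒲) (ψ : 𝒲 → ℝ) : ℝ :=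
  ∫ ω, ψ (W ω) ∂P

/-- The tests `T_n` based on the samples `W_n` are asymptotically optimal at level `α` for testing
`P0` against `P1 n`: they have asymptotic level `α`, and no sequence of tests whose level is
asymptotically at most `α` has an asymptotically larger power. -/
structure IsAsymptoticallyOptimal {Ω : Type*} [MeasurableSpace Ω] {𝒲 : ℕ → Type*}
    [∀ n, MeasurableSpace (𝒲 n)] (P0 : Measure Ω) (P1 : ℕ → Measure Ω) (W : ∀ n, Ω → 𝒲 n)
    (α : ℝ) (T : ∀ n, 𝒲 n → ℝ) : Prop where
  isTest : ∀ n, IsTest (T n)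
  level : Tendsto (fun n => rejectionProb P0 (W n) (T n)) atTop (𝓝 α)
  optimal : ∀ ψ : ∀ n, 𝒲 n → ℝ, (∀ n, IsTest (ψ n)) →
    (∀ δ : ℝ, 0 < δ → ∀ᶠ n in atTop, rejectionProb P0 (W n) (ψ n) ≤ α + δ) →
    ∀ δ : ℝ, 0 < δ → ∀ᶠ n in atTop,
      rejectionProb (P1 n) (W n) (ψ n) ≤ rejectionProb (P1 n) (W n) (T n) + δ

end

/-! The correction is built so that the gradient at the estimate, applied to the step, gives exactly
`D` (`fderiv_modifiedEstimate_sub`). The tangent condition then cancels the `-D` of (E.1), and the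
central sequence at the modified estimate agrees with the one at `φ₀` up to `o_P(1)`. The gradient
has exact order `√n`, so the correction is `O_P(n^{-1/2})`. The modified estimate is therefore
consistent, and so is `τ` evaluated at it. Slutsky (`LAN.tendstoInDistribution_prodMk`) gives the
joint limit under the null: the studentized statistic and the log-likelihood ratio converge to `(x,
τ x - τ² / 2)` with `x` standard normal.

It remains to pass to the alternatives, as in Le Cam's third lemma. Weighting `N(0, 1)` by `exp (τ x
- τ² / 2)` gives `N(τ, 1)`, but weak convergence cannot be applied to the unbounded function `exp`.
Instead, `exp` is replaced by bounded continuous `h ≤ exp`: the null integral of `ψ * h(Λ)` is at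
most the power of `ψ`. Applied to `ψ`, this bounds power from below (`eventually_le_rejectionProb`);
applied to `1 - ψ`, from above. With `h` cut off at the Neyman–Pearson critical value, the upper
bound is the optimal limiting power (`eventually_rejectionProb_le`), which the modified test
attains. With `h` close to `exp`, it gives contiguity (`tendsto_measure_zero_of_contiguous`), hence
the statement about the estimated power. -/

/-! ### The Gaussian limit experiment `N(0, 1)` against `N(τ, 1)`. -/

theorem gaussianPDFReal_shift (τ x : ℝ) :
    gaussianPDFReal 0 1 x * Real.exp (τ * x - τ ^ 2 / 2) = gaussianPDFReal τ 1 x := by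
  simp only [gaussianPDFReal, mul_assoc, ← Real.exp_add]
  congr 2
  push_cast
  ring

theorem integral_exp_mul_gaussianReal (τ : ℝ) (g : ℝ → ℝ) :
    ∫ x, Real.exp (τ * x - τ ^ 2 / 2) * g x ∂gaussianReal 0 1 = ∫ x, g x ∂gaussianReal τ 1 := by
  rw [integral_gaussianReal_eq_integral_smul one_ne_zero,
    integral_gaussianReal_eq_integral_smul one_ne_zero]
  refine integral_congr_ae (ae_of_all _ fun x => ?_)
  simp only [smul_eq_mul, ← mul_assoc, gaussianPDFReal_shift]

theorem integrable_exp_gaussianReal (τ : ℝ) :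
    Integrable (fun x => Real.exp (τ * x - τ ^ 2 / 2)) (gaussianReal 0 1) := by
  simp only [sub_eq_add_neg, Real.exp_add]
  exact (integrable_exp_mul_gaussianReal τ).mul_const _

theorem integral_exp_gaussianReal (τ : ℝ) :
    ∫ x, Real.exp (τ * x - τ ^ 2 / 2) ∂gaussianReal 0 1 = 1 := by
  simpa using integral_exp_mul_gaussianReal τ (fun _ => 1)

theorem stdNormalCDF_eq_measureReal (τ z : ℝ) :
    stdNormalCDF (z - τ) = (gaussianReal τ 1).real (Set.Iic z) := by
  have h : (gaussianReal 0 1).map (· + τ) = gaussianReal τ 1 := by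
    rw [gaussianReal_map_add_const, zero_add]
  rw [stdNormalCDF, cdf_eq_real, ← h, map_measureReal_apply (by fun_prop) measurableSet_Iic]
  congr 1
  ext x
  simp [le_sub_iff_add_le]

theorem measureReal_Ioi_gaussianReal (τ z : ℝ) :
    (gaussianReal τ 1).real (Set.Ioi z) = 1 - stdNormalCDF (z - τ) := by
  rw [stdNormalCDF_eq_measureReal, ← Set.compl_Iic, probReal_compl_eq_one_sub measurableSet_Iic]

/-- A jump of a distribution function is an atom of its law, and a nondegenerate Gaussian has none.
-/
theorem continuous_stdNormalCDF : Continuous stdNormalCDF := by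
  have := nullSingletonClass_gaussianReal (μ := 0) (one_ne_zero : (1 : NNReal) ≠ 0)
  refine continuous_iff_continuousAt.2 fun a => ?_
  have h : (cdf (gaussianReal 0 1)).measure {a} = 0 := by rw [measure_cdf]; exact measure_singleton a
  rw [StieltjesFunction.measure_singleton, ENNReal.ofReal_eq_zero] at h
  have hm : Monotone (cdf (gaussianReal 0 1)) := monotone_cdf _
  refine (hm.continuousAt_iff_leftLim_eq_rightLim).2 ?_
  rw [StieltjesFunction.rightLim_eq]
  exact le_antisymm (hm.leftLim_le le_rfl) (by linarith)

theorem stdNormalCDF_normalQuantile {α : ℝ} (hα : α ∈ Set.Ioo (0 : ℝ) 1) :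
    stdNormalCDF (normalQuantile α) = 1 - α := by
  have hm : Monotone stdNormalCDF := monotone_cdf _
  obtain ⟨a, ha⟩ : ∃ a, stdNormalCDF a < 1 - α :=
    ((tendsto_cdf_atBot (gaussianReal 0 1)).eventually_lt_const (by linarith [hα.2])).exists
  obtain ⟨b, hb⟩ : ∃ b, 1 - α < stdNormalCDF b :=
    ((tendsto_cdf_atTop (gaussianReal 0 1)).eventually_const_lt (by linarith [hα.1])).exists
  obtain ⟨y, hy⟩ := mem_range_of_exists_le_of_exists_ge continuous_stdNormalCDF
    ⟨a, ha.le⟩ ⟨b, hb.le⟩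
  have hbdd : BddBelow {x : ℝ | 1 - α ≤ stdNormalCDF x} :=
    ⟨a, fun x hx => le_of_not_gt fun hxa => absurd (hm hxa.le) (not_le.2 (ha.trans_le hx))⟩
  have hcl : IsClosed {x : ℝ | 1 - α ≤ stdNormalCDF x} :=
    isClosed_le continuous_const continuous_stdNormalCDF
  -- Closedness puts the infimum in the set; the point `y` from the intermediate value theorem,
  -- where `1 - α` is attained exactly, gives the other inequality.
  refine le_antisymm ?_ (hcl.csInf_mem ⟨y, hy.ge⟩ hbdd)
  exact (hm (csInf_le hbdd hy.ge)).trans hy.le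

theorem integral_indicator_exp_gaussianReal (τ z : ℝ) :
    ∫ x, Real.exp (τ * x - τ ^ 2 / 2) * (Set.Ioi z).indicator (fun _ => 1) x ∂gaussianReal 0 1 =
      1 - stdNormalCDF (z - τ) := by
  rw [integral_exp_mul_gaussianReal, integral_indicator_const _ measurableSet_Ioi,
    measureReal_Ioi_gaussianReal, smul_eq_mul, mul_one]

/-- Since `τ > 0`, the likelihood ratio is increasing and crosses the cutoff exactly at `z`. The
term with coefficient `exp (τ z - τ² / 2)` later cancels the level in the Neyman–Pearson bound. -/
theorem integral_min_exp_gaussianReal {τ : ℝ} (hτ : 0 < τ) (z : ℝ) :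
    ∫ x, min (Real.exp (τ * x - τ ^ 2 / 2)) (Real.exp (τ * z - τ ^ 2 / 2)) ∂gaussianReal 0 1 =
      stdNormalCDF (z - τ) + Real.exp (τ * z - τ ^ 2 / 2) * (1 - stdNormalCDF z) := by
  have h : ∀ x, min (Real.exp (τ * x - τ ^ 2 / 2)) (Real.exp (τ * z - τ ^ 2 / 2)) =
      Real.exp (τ * x - τ ^ 2 / 2) * (Set.Iic z).indicator (fun _ => 1) x +
        (Set.Ioi z).indicator (fun _ => Real.exp (τ * z - τ ^ 2 / 2)) x := by
    intro x
    rcases le_or_gt x z with hx | hx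
    · rw [min_eq_left (Real.exp_le_exp.2 (by nlinarith))]
      simp [hx, not_lt.2 hx]
    · rw [min_eq_right (Real.exp_le_exp.2 (by nlinarith))]
      simp [hx, not_le.2 hx]
  have hi : ∀ x, Real.exp (τ * x - τ ^ 2 / 2) * (Set.Iic z).indicator (fun _ => 1) x =
      (Set.Iic z).indicator (fun x => Real.exp (τ * x - τ ^ 2 / 2)) x := by
    intro x
    by_cases hx : x ∈ Set.Iic z <;> simp [hx]
  simp_rw [h]
  rw [integral_add, integral_exp_mul_gaussianReal, integral_indicator_const _ measurableSet_Iic,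
    integral_indicator_const _ measurableSet_Ioi, ← stdNormalCDF_eq_measureReal,
    measureReal_Ioi_gaussianReal]
  · simp [mul_comm]
  · simp_rw [hi]
    exact (integrable_exp_gaussianReal τ).indicator measurableSet_Iic
  · exact (integrable_const _).indicator measurableSet_Ioi

/-! ### Tests, densities and the Neyman–Pearson inequality. -/

theorem IsTest.integrable_comp {Ω 𝒲 : Type*} [MeasurableSpace Ω] [MeasurableSpace 𝒲]
    {P : Measure Ω} [IsFiniteMeasure P] {W : Ω → 𝒲} (hW : Measurable W) {ψ : 𝒲 → ℝ}
    (hψ : IsTest ψ) : Integrable (fun ω => ψ (W ω)) P :=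
  Integrable.of_bound (hψ.1.comp hW).aestronglyMeasurable 1 (ae_of_all _ fun ω => by
    rw [Real.norm_of_nonneg (hψ.2 _).1]; exact (hψ.2 _).2)

theorem IsTest.one_sub {𝒲 : Type*} [MeasurableSpace 𝒲] {ψ : 𝒲 → ℝ} (hψ : IsTest ψ) :
    IsTest (fun w => 1 - ψ w) :=
  ⟨measurable_const.sub hψ.1, fun w => ⟨by linarith [(hψ.2 w).2], by linarith [(hψ.2 w).1]⟩⟩

theorem IsTest.indicator {𝒲 : Type*} [MeasurableSpace 𝒲] {A : Set 𝒲} (hA : MeasurableSet A) :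
    IsTest (A.indicator fun _ => (1 : ℝ)) :=
  ⟨measurable_const.indicator hA, fun w => by by_cases hw : w ∈ A <;> simp [hw]⟩

theorem rejectionProb_indicator {Ω 𝒲 : Type*} [MeasurableSpace Ω] [MeasurableSpace 𝒲]
    (P : Measure Ω) {W : Ω → 𝒲} (hW : Measurable W) {A : Set 𝒲} (hA : MeasurableSet A) :
    rejectionProb P W (A.indicator fun _ => (1 : ℝ)) = P.real (W ⁻¹' A) := by
  have h : (fun ω => A.indicator (fun _ => (1 : ℝ)) (W ω)) = (W ⁻¹' A).indicator 1 := by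
    ext ω; by_cases hw : W ω ∈ A <;> simp [hw]
  rw [rejectionProb, h, integral_indicator_one (hW hA)]

/-- If `h` is dominated by the likelihood ratio `g1 / g0`, then the integral of `ψ * h` under the
first law is at most the integral of `ψ` under the second law. -/
theorem integral_mul_le_of_hasDensity {Ω 𝒲 : Type*} [MeasurableSpace Ω] [MeasurableSpace 𝒲]
    {P0 P1 : Measure Ω} [IsProbabilityMeasure P1] {W : Ω → 𝒲}
    (hW : Measurable W) {μ : Measure 𝒲} {g0 g1 : 𝒲 → ℝ} (h0 : HasDensity P0 W μ g0)
    (h1 : HasDensity P1 W μ g1) {ψ : 𝒲 → ℝ} (hψ : IsTest ψ) {h : 𝒲 → ℝ} (hm : Measurable h)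
    (hnn : ∀ w, 0 ≤ h w) (hle : ∀ w, h w * g0 w ≤ g1 w) :
    ∫ ω, ψ (W ω) * h (W ω) ∂P0 ≤ ∫ ω, ψ (W ω) ∂P1 := by
  have hpm : Measurable fun w => ψ w * h w := hψ.1.mul hm
  -- Both integrals are moved to the dominating measure `μ`, where the comparison is pointwise.
  have e0 : ∫⁻ ω, ENNReal.ofReal (ψ (W ω) * h (W ω)) ∂P0 =
      ∫⁻ w, ENNReal.ofReal (g0 w) * ENNReal.ofReal (ψ w * h w) ∂μ := by
    rw [← lintegral_map (f := fun w => ENNReal.ofReal (ψ w * h w)) hpm.ennreal_ofReal hW, h0.2.2,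
      lintegral_withDensity_eq_lintegral_mul _ h0.1.ennreal_ofReal hpm.ennreal_ofReal]
    rfl
  have e1 : ∫⁻ ω, ENNReal.ofReal (ψ (W ω)) ∂P1 =
      ∫⁻ w, ENNReal.ofReal (g1 w) * ENNReal.ofReal (ψ w) ∂μ := by
    rw [← lintegral_map (f := fun w => ENNReal.ofReal (ψ w)) hψ.1.ennreal_ofReal hW, h1.2.2,
      lintegral_withDensity_eq_lintegral_mul _ h1.1.ennreal_ofReal hψ.1.ennreal_ofReal]
    rfl
  rw [integral_eq_lintegral_of_nonneg_ae
      (ae_of_all _ fun ω => mul_nonneg (hψ.2 _).1 (hnn _)) (hpm.comp hW).aestronglyMeasurable,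
    integral_eq_lintegral_of_nonneg_ae (ae_of_all _ fun ω => (hψ.2 _).1)
      (hψ.1.comp hW).aestronglyMeasurable]
  refine ENNReal.toReal_mono (hψ.integrable_comp hW).lintegral_lt_top.ne ?_
  rw [e0, e1]
  refine lintegral_mono fun w => ?_
  rw [← ENNReal.ofReal_mul (h0.2.1 w), ← ENNReal.ofReal_mul (h1.2.1 w)]
  refine ENNReal.ofReal_le_ofReal ?_
  nlinarith [mul_le_mul_of_nonneg_left (hle w) (hψ.2 w).1]

/-- Functions of the log-likelihood ratio `Λ` of `P1` to `P0` that are dominated by `exp` and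
vanish at `0` (the value of `Λ` where the density under `P1` vanishes) bound the power of
tests from below. -/
structure IsLogLikelihoodRatio {Ω 𝒲 : Type*} [MeasurableSpace Ω] [MeasurableSpace 𝒲]
    (P0 P1 : Measure Ω) (W : Ω → 𝒲) (Λ : Ω → ℝ) : Prop where
  measurable : Measurable Λ
  integral_le : ∀ ψ : 𝒲 → ℝ, IsTest ψ → ∀ h : ℝ → ℝ, Measurable h → (∀ x, 0 ≤ h x) → h 0 = 0 →
    (∀ x, h x ≤ Real.exp x) → ∫ ω, ψ (W ω) * h (Λ ω) ∂P0 ≤ rejectionProb P1 W ψ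

theorem HasDensity.isLogLikelihoodRatio {Ω 𝒲 : Type*} [MeasurableSpace Ω] [MeasurableSpace 𝒲]
    {P0 P1 : Measure Ω} [IsProbabilityMeasure P1] {W : Ω → 𝒲}
    (hW : Measurable W) {μ : Measure 𝒲} {g0 g1 : 𝒲 → ℝ} (h0 : HasDensity P0 W μ g0)
    (h1 : HasDensity P1 W μ g1) :
    IsLogLikelihoodRatio P0 P1 W (fun ω => Real.log (g1 (W ω) / g0 (W ω))) where
  measurable := (Real.measurable_log.comp (h1.1.div h0.1)).comp hW
  integral_le ψ hψ h hm hnn hz hle := by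
    refine integral_mul_le_of_hasDensity (h := fun w => h (Real.log (g1 w / g0 w))) hW h0 h1 hψ
      (hm.comp (Real.measurable_log.comp (h1.1.div h0.1))) (fun _ => hnn _) fun w => ?_
    rcases (h0.2.1 w).eq_or_lt' with hw0 | hw0
    · simp [hw0, h1.2.1 w]
    rcases (h1.2.1 w).eq_or_lt' with hw1 | hw1
    -- Here the ratio is `0` but `Real.log 0 = 0`, so `exp Λ = 1` exceeds the ratio; `h 0 = 0`
    -- repairs this.
    · simp [hw1, hz]
    · calc h (Real.log (g1 w / g0 w)) * g0 w ≤ g1 w / g0 w * g0 w := by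
            gcongr
            exact (hle _).trans_eq (Real.exp_log (div_pos hw1 hw0))
        _ = g1 w := div_mul_cancel₀ _ hw0.ne'

theorem integrable_comp_of_mem_Icc {Ω : Type*} [MeasurableSpace Ω] {P : Measure Ω}
    [IsFiniteMeasure P] {Λ : Ω → ℝ} (hΛ : Measurable Λ) {h : ℝ → ℝ} (hm : Measurable h) {k : ℝ}
    (hk : ∀ x, h x ∈ Set.Icc 0 k) : Integrable (fun ω => h (Λ ω)) P :=
  Integrable.of_bound (hm.comp hΛ).aestronglyMeasurable k (ae_of_all _ fun ω => by
    rw [Real.norm_of_nonneg (hk _).1]; exact (hk _).2)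

/-- The Neyman-Pearson bound for the power of a test. -/
theorem IsLogLikelihoodRatio.rejectionProb_le {Ω 𝒲 : Type*} [MeasurableSpace Ω]
    [MeasurableSpace 𝒲] {P0 P1 : Measure Ω} [IsProbabilityMeasure P0] [IsProbabilityMeasure P1]
    {W : Ω → 𝒲} {Λ : Ω → ℝ} (hL : IsLogLikelihoodRatio P0 P1 W Λ) (hW : Measurable W)
    {ψ : 𝒲 → ℝ} (hψ : IsTest ψ) {h : ℝ → ℝ} (hm : Measurable h) (hz : h 0 = 0)
    (hle : ∀ x, h x ≤ Real.exp x) {k : ℝ} (hk : ∀ x, h x ∈ Set.Icc 0 k) :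
    rejectionProb P1 W ψ ≤ k * rejectionProb P0 W ψ + (1 - ∫ ω, h (Λ ω) ∂P0) := by
  -- A lower bound on the power of `1 - ψ` is an upper bound on that of `ψ`.
  have h1 := hL.integral_le _ hψ.one_sub h hm (fun x => (hk x).1) hz hle
  have hi := integrable_comp_of_mem_Icc (P := P0) hL.measurable hm hk
  have hi2 : Integrable (fun ω => ψ (W ω) * h (Λ ω)) P0 :=
    hi.bdd_mul (hψ.1.comp hW).aestronglyMeasurable (c := 1) (ae_of_all _ fun ω => by
      rw [Real.norm_of_nonneg (hψ.2 _).1]; exact (hψ.2 _).2)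
  have h2 : ∫ ω, ψ (W ω) * h (Λ ω) ∂P0 ≤ k * rejectionProb P0 W ψ := by
    rw [rejectionProb, ← integral_const_mul]
    refine integral_mono hi2 ((hψ.integrable_comp hW).const_mul k) fun ω => ?_
    dsimp only
    rw [mul_comm k]
    exact mul_le_mul_of_nonneg_left (hk _).2 (hψ.2 _).1
  simp only [rejectionProb, sub_mul, one_mul] at h1
  rw [integral_sub hi hi2, integral_sub (integrable_const _) (hψ.integrable_comp hW)] at h1
  simp only [integral_const, probReal_univ, smul_eq_mul, mul_one] at h1
  rw [rejectionProb] at h2 ⊢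
  rw [rejectionProb]
  linarith

/-! ### Continuous truncations -/

/-- A continuous function with values in `[0, 1]` increasing with `j` to the indicator function of
the positive half-line. -/
noncomputable def ramp (j : ℕ) (x : ℝ) : ℝ := min 1 (j * max x 0)

theorem continuous_ramp (j : ℕ) : Continuous (ramp j) := by unfold ramp; fun_prop

theorem ramp_nonneg (j : ℕ) (x : ℝ) : 0 ≤ ramp j x := by unfold ramp; positivity

theorem ramp_le_one (j : ℕ) (x : ℝ) : ramp j x ≤ 1 := min_le_left _ _

theorem ramp_of_nonpos (j : ℕ) {x : ℝ} (hx : x ≤ 0) : ramp j x = 0 := by simp [ramp, hx]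

theorem tendsto_ramp {x : ℝ} (hx : 0 < x) : Tendsto (fun j => ramp j x) atTop (𝓝 1) := by
  refine tendsto_const_nhds.congr' ?_
  filter_upwards [(tendsto_natCast_atTop_atTop.atTop_mul_const hx).eventually_ge_atTop 1] with j hj
  simp [ramp, hx.le, hj]

/-- A continuous truncation of `exp` which vanishes at `0`. -/
noncomputable def truncExp (k : ℝ) (j : ℕ) (x : ℝ) : ℝ := min (Real.exp x) k * ramp j |x|

theorem continuous_truncExp (k : ℝ) (j : ℕ) : Continuous (truncExp k j) := by
  have := continuous_ramp j
  unfold truncExp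
  fun_prop

theorem truncExp_nonneg {k : ℝ} (hk : 0 ≤ k) (j : ℕ) (x : ℝ) : 0 ≤ truncExp k j x :=
  mul_nonneg (le_min (Real.exp_pos _).le hk) (ramp_nonneg _ _)

theorem truncExp_le_min {k : ℝ} (hk : 0 ≤ k) (j : ℕ) (x : ℝ) :
    truncExp k j x ≤ min (Real.exp x) k :=
  mul_le_of_le_one_right (le_min (Real.exp_pos _).le hk) (ramp_le_one _ _)

theorem truncExp_zero (k : ℝ) (j : ℕ) : truncExp k j 0 = 0 := by
  simp [truncExp, ramp_of_nonpos]

theorem truncExp_le_exp {k : ℝ} (hk : 0 ≤ k) (j : ℕ) (x : ℝ) : truncExp k j x ≤ Real.exp x :=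
  (truncExp_le_min hk j x).trans (min_le_left _ _)

theorem truncExp_mem_Icc {k : ℝ} (hk : 0 ≤ k) (j : ℕ) (x : ℝ) : truncExp k j x ∈ Set.Icc 0 k :=
  ⟨truncExp_nonneg hk j x, (truncExp_le_min hk j x).trans (min_le_right _ _)⟩

/-- Only `x = τ / 2` is excluded, so forcing the truncations to vanish at `0` costs nothing in the
limit. -/
theorem ae_shift_ne_zero {τ : ℝ} (hτ : 0 < τ) :
    ∀ᵐ x ∂gaussianReal 0 1, τ * x - τ ^ 2 / 2 ≠ 0 := by
  have := nullSingletonClass_gaussianReal (μ := 0) (one_ne_zero : (1 : NNReal) ≠ 0)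
  filter_upwards [(Set.countable_singleton (τ / 2)).ae_notMem (gaussianReal 0 1)] with x hx h
  refine hx (Set.mem_singleton_iff.2 (mul_left_cancel₀ hτ.ne' ?_))
  linarith

theorem tendsto_integral_truncExp {τ : ℝ} (hτ : 0 < τ) {k : ℝ} (hk : 0 ≤ k) :
    Tendsto (fun j => ∫ x, truncExp k j (τ * x - τ ^ 2 / 2) ∂gaussianReal 0 1) atTop
      (𝓝 (∫ x, min (Real.exp (τ * x - τ ^ 2 / 2)) k ∂gaussianReal 0 1)) := by
  refine tendsto_integral_of_dominated_convergence (fun _ => k)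
    (fun j => ((continuous_truncExp k j).comp (by fun_prop)).aestronglyMeasurable)
    (integrable_const _) (fun j => ae_of_all _ fun x => ?_) ?_
  · rw [Real.norm_of_nonneg (truncExp_nonneg hk _ _)]
    exact (truncExp_mem_Icc hk _ _).2
  · filter_upwards [ae_shift_ne_zero hτ] with x hx
    simpa [truncExp] using (tendsto_ramp (abs_pos.2 hx)).const_mul
      (min (Real.exp (τ * x - τ ^ 2 / 2)) k)

/-- The cutoff level and the ramp grow together, with the integrable likelihood ratio itself as
dominating function. -/
theorem tendsto_integral_mul_truncExp {τ : ℝ} (hτ : 0 < τ) {g : ℕ → ℝ → ℝ} {g' : ℝ → ℝ}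
    (hg : ∀ j, Continuous (g j)) (hg01 : ∀ j x, g j x ∈ Set.Icc (0 : ℝ) 1)
    (hlim : ∀ x, Tendsto (fun j => g j x) atTop (𝓝 (g' x))) :
    Tendsto (fun j : ℕ => ∫ x, truncExp j j (τ * x - τ ^ 2 / 2) * g j x ∂gaussianReal 0 1) atTop
      (𝓝 (∫ x, Real.exp (τ * x - τ ^ 2 / 2) * g' x ∂gaussianReal 0 1)) := by
  refine tendsto_integral_of_dominated_convergence
    (fun x => Real.exp (τ * x - τ ^ 2 / 2))
    (fun j => (((continuous_truncExp j j).comp (by fun_prop)).mul (hg j)).aestronglyMeasurable)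
    (integrable_exp_gaussianReal τ) (fun j => ae_of_all _ fun x => ?_) ?_
  · rw [Real.norm_of_nonneg
      (mul_nonneg (truncExp_nonneg j.cast_nonneg _ _) (hg01 j x).1)]
    exact (mul_le_of_le_one_right (truncExp_nonneg j.cast_nonneg _ _) (hg01 j x).2).trans
      (truncExp_le_exp j.cast_nonneg _ _)
  · filter_upwards [ae_shift_ne_zero hτ] with x hx
    refine Tendsto.mul ?_ (hlim x)
    refine Tendsto.congr' ?_ (by
      simpa using (tendsto_ramp (abs_pos.2 hx)).const_mul (Real.exp (τ * x - τ ^ 2 / 2)))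
    filter_upwards [tendsto_natCast_atTop_atTop.eventually_ge_atTop
      (Real.exp (τ * x - τ ^ 2 / 2))] with j hj
    rw [truncExp, min_eq_left hj]

/-! ### From the joint limit under the null to level and power. -/

theorem tendsto_integral_of_tendstoInDistribution {Ω Ω' E : Type*} [MeasurableSpace Ω]
    [MeasurableSpace Ω'] [TopologicalSpace E] [MeasurableSpace E] [BorelSpace E]
    {P : Measure Ω} [IsProbabilityMeasure P] {Q : Measure Ω'} [IsProbabilityMeasure Q]
    {X : ℕ → Ω → E} {Z : Ω' → E} (h : TendstoInDistribution X atTop Z (fun _ => P) Q)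
    {g : E → ℝ} (hg : Continuous g) {C : ℝ} (hC : ∀ x, ‖g x‖ ≤ C) :
    Tendsto (fun n => ∫ ω, g (X n ω) ∂P) atTop (𝓝 (∫ x, g (Z x) ∂Q)) := by
  have h1 := (ProbabilityMeasure.tendsto_iff_forall_integral_tendsto.1 h.tendsto)
    (BoundedContinuousFunction.ofNormedAddCommGroup g hg C hC)
  simp only [ProbabilityMeasure.coe_mk, BoundedContinuousFunction.coe_ofNormedAddCommGroup] at h1
  rw [integral_map h.aemeasurable_limit (hg.measurable.aestronglyMeasurable)] at h1
  refine h1.congr fun n => ?_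
  rw [integral_map (h.forall_aemeasurable n) (hg.measurable.aestronglyMeasurable)]

/-- Contiguity of the alternatives to the null law. -/
theorem tendsto_measure_zero_of_contiguous {Ω : Type*} [MeasurableSpace Ω] {P0 : Measure Ω}
    [IsProbabilityMeasure P0] {P1 : ℕ → Measure Ω} [∀ n, IsProbabilityMeasure (P1 n)]
    {𝒲 : ℕ → Type*} [∀ n, MeasurableSpace (𝒲 n)] {W : ∀ n, Ω → 𝒲 n} (hW : ∀ n, Measurable (W n))
    {U Λ : ℕ → Ω → ℝ} {τ : ℝ} (hτ : 0 < τ)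
    (hL : ∀ n : ℕ, 1 ≤ n → IsLogLikelihoodRatio P0 (P1 n) (W n) (Λ n))
    (hU : TendstoInDistribution (fun n ω => (U n ω, Λ n ω)) atTop
      (fun x => (x, τ * x - τ ^ 2 / 2)) (fun _ => P0) (gaussianReal 0 1))
    {A : ∀ n, Set (𝒲 n)} (hA : ∀ n, MeasurableSet (A n))
    (h0 : Tendsto (fun n => P0 (W n ⁻¹' A n)) atTop (𝓝 0)) :
    Tendsto (fun n => P1 n (W n ⁻¹' A n)) atTop (𝓝 0) := by
  have h0' : Tendsto (fun n => P0.real (W n ⁻¹' A n)) atTop (𝓝 0) :=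
    (ENNReal.tendsto_toReal ENNReal.zero_ne_top).comp h0
  suffices h : Tendsto (fun n => (P1 n).real (W n ⁻¹' A n)) atTop (𝓝 0) by
    simpa using ENNReal.tendsto_ofReal h
  refine Metric.tendsto_nhds.2 fun δ hδ => ?_
  -- The limiting likelihood ratio has total mass `1`, so a fixed truncation loses at most `δ / 2`
  -- of it.
  have hlim := tendsto_integral_mul_truncExp hτ (g := fun _ _ => 1) (g' := fun _ => 1)
    (fun _ => continuous_const) (fun _ _ => by simp) (fun _ => tendsto_const_nhds)
  simp only [mul_one, integral_exp_gaussianReal] at hlim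
  obtain ⟨j, hj⟩ := (hlim.eventually_const_lt (show 1 - δ / 2 < 1 by linarith)).exists
  have hn := tendsto_integral_of_tendstoInDistribution hU
    (g := fun x => truncExp j j x.2) ((continuous_truncExp j j).comp continuous_snd) (C := j)
    (fun x => by
      rw [Real.norm_of_nonneg (truncExp_nonneg j.cast_nonneg _ _)]
      exact (truncExp_mem_Icc j.cast_nonneg _ _).2)
  have h2 := h0'.const_mul (j : ℝ)
  rw [mul_zero] at h2
  filter_upwards [hn.eventually_const_lt hj, eventually_ge_atTop 1,
    h2.eventually_lt_const (half_pos hδ)] with n h1 hn1 h3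
  have h4 := (hL n hn1).rejectionProb_le (hW n) (IsTest.indicator (hA n))
    (continuous_truncExp j j).measurable (truncExp_zero _ _) (truncExp_le_exp j.cast_nonneg _)
    (truncExp_mem_Icc j.cast_nonneg j)
  rw [rejectionProb_indicator _ (hW n) (hA n), rejectionProb_indicator _ (hW n) (hA n)] at h4
  rw [Real.dist_0_eq_abs, abs_of_nonneg measureReal_nonneg]
  linarith

/-- The asymptotic Neyman-Pearson bound. -/
theorem eventually_rejectionProb_le {Ω : Type*} [MeasurableSpace Ω] {P0 : Measure Ω}
    [IsProbabilityMeasure P0] {P1 : ℕ → Measure Ω} [∀ n, IsProbabilityMeasure (P1 n)]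
    {𝒲 : ℕ → Type*} [∀ n, MeasurableSpace (𝒲 n)] {W : ∀ n, Ω → 𝒲 n} (hW : ∀ n, Measurable (W n))
    {U Λ : ℕ → Ω → ℝ} {τ : ℝ} (hτ : 0 < τ)
    (hL : ∀ n : ℕ, 1 ≤ n → IsLogLikelihoodRatio P0 (P1 n) (W n) (Λ n))
    (hU : TendstoInDistribution (fun n ω => (U n ω, Λ n ω)) atTop
      (fun x => (x, τ * x - τ ^ 2 / 2)) (fun _ => P0) (gaussianReal 0 1))
    {z : ℝ} {ψ : ∀ n, 𝒲 n → ℝ} (hψ : ∀ n, IsTest (ψ n))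
    (hlevel : ∀ δ : ℝ, 0 < δ → ∀ᶠ n in atTop,
      rejectionProb P0 (W n) (ψ n) ≤ 1 - stdNormalCDF z + δ) {δ : ℝ} (hδ : 0 < δ) :
    ∀ᶠ n in atTop, rejectionProb (P1 n) (W n) (ψ n) ≤ 1 - stdNormalCDF (z - τ) + δ := by
  -- The limiting likelihood ratio at the critical point `z`, that is, the Neyman–Pearson
  -- multiplier.
  set k := Real.exp (τ * z - τ ^ 2 / 2) with hkdef
  have hk : 0 < k := Real.exp_pos _
  have hlim := tendsto_integral_truncExp hτ hk.le
  rw [integral_min_exp_gaussianReal hτ z] at hlim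
  obtain ⟨j, hj⟩ := (hlim.eventually_const_lt (sub_lt_self _ (half_pos hδ))).exists
  have hn := tendsto_integral_of_tendstoInDistribution hU
    (g := fun x => truncExp k j x.2) ((continuous_truncExp k j).comp continuous_snd) (C := k)
    (fun x => by
      rw [Real.norm_of_nonneg (truncExp_nonneg hk.le _ _)]
      exact (truncExp_mem_Icc hk.le _ _).2)
  filter_upwards [hn.eventually_const_lt hj, eventually_ge_atTop 1,
    -- The level enters the bound multiplied by `k`, hence the division by `k`.
    hlevel (δ / 2 / k) (by positivity)] with n h1 hn1 h3
  have h4 := (hL n hn1).rejectionProb_le (hW n) (hψ n)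
    (continuous_truncExp k j).measurable (truncExp_zero _ _) (truncExp_le_exp hk.le _)
    (truncExp_mem_Icc hk.le j)
  have h5 := mul_le_mul_of_nonneg_left h3 hk.le
  rw [mul_add, mul_div_cancel₀ _ hk.ne'] at h5
  linarith

/-- The lower bound for the asymptotic power of the Neyman-Pearson test. -/
theorem eventually_le_rejectionProb {Ω : Type*} [MeasurableSpace Ω] {P0 : Measure Ω}
    [IsProbabilityMeasure P0] {P1 : ℕ → Measure Ω} [∀ n, IsProbabilityMeasure (P1 n)]
    {𝒲 : ℕ → Type*} [∀ n, MeasurableSpace (𝒲 n)] {W : ∀ n, Ω → 𝒲 n} (hW : ∀ n, Measurable (W n))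
    {U Λ : ℕ → Ω → ℝ} {τ : ℝ} (hτ : 0 < τ)
    (hL : ∀ n : ℕ, 1 ≤ n → IsLogLikelihoodRatio P0 (P1 n) (W n) (Λ n))
    (hU : TendstoInDistribution (fun n ω => (U n ω, Λ n ω)) atTop
      (fun x => (x, τ * x - τ ^ 2 / 2)) (fun _ => P0) (gaussianReal 0 1))
    {z : ℝ} {ψ : ∀ n, 𝒲 n → ℝ} (hψ : ∀ n, IsTest (ψ n))
    (hreject : ∀ n ω, z ≤ U n ω → ψ n (W n ω) = 1) {δ : ℝ} (hδ : 0 < δ) :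
    ∀ᶠ n in atTop, 1 - stdNormalCDF (z - τ) - δ ≤ rejectionProb (P1 n) (W n) (ψ n) := by
  -- The ramps are continuous minorants of the rejection indicator; their limit omits the point `z`,
  -- which is null for the Gaussian.
  have hlim := tendsto_integral_mul_truncExp hτ (g := fun j x => ramp j (x - z))
    (g' := (Set.Ioi z).indicator fun _ => 1)
    (fun j => (continuous_ramp j).comp (by fun_prop))
    (fun j x => ⟨ramp_nonneg _ _, ramp_le_one _ _⟩) (fun x => by
      rcases le_or_gt x z with hx | hx
      · simp [ramp_of_nonpos _ (sub_nonpos.2 hx), not_lt.2 hx]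
      · simpa [hx] using tendsto_ramp (sub_pos.2 hx))
  rw [integral_indicator_exp_gaussianReal] at hlim
  obtain ⟨j, hj⟩ := (hlim.eventually_const_lt (sub_lt_self _ hδ)).exists
  have hj0 : (0 : ℝ) ≤ j := j.cast_nonneg
  have hbd : ∀ u l, 0 ≤ truncExp j j l * ramp j (u - z) ∧
      truncExp j j l * ramp j (u - z) ≤ j := fun u l =>
    ⟨mul_nonneg (truncExp_nonneg hj0 _ _) (ramp_nonneg _ _),
      (mul_le_of_le_one_right (truncExp_nonneg hj0 _ _) (ramp_le_one _ _)).trans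
        (truncExp_mem_Icc hj0 _ _).2⟩
  have hcont : Continuous fun x : ℝ × ℝ => truncExp j j x.2 * ramp j (x.1 - z) :=
    ((continuous_truncExp j j).comp continuous_snd).mul ((continuous_ramp j).comp (by fun_prop))
  have hn := tendsto_integral_of_tendstoInDistribution hU hcont (C := j)
    (fun x => by rw [Real.norm_of_nonneg (hbd _ _).1]; exact (hbd _ _).2)
  filter_upwards [hn.eventually_const_lt hj, eventually_ge_atTop 1] with n h1 hn1
  refine h1.le.trans (le_trans ?_ ((hL n hn1).integral_le _ (hψ n) (truncExp j j)
    (continuous_truncExp j j).measurable (truncExp_nonneg hj0 _) (truncExp_zero _ _)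
    (truncExp_le_exp hj0 _)))
  refine integral_mono ?_ ?_ fun ω => ?_
  · refine Integrable.of_bound
      (hcont.measurable.comp_aemeasurable (hU.forall_aemeasurable n)).aestronglyMeasurable j
      (ae_of_all _ fun ω => ?_)
    rw [Real.norm_of_nonneg (hbd _ _).1]
    exact (hbd _ _).2
  · exact (integrable_comp_of_mem_Icc (hL n hn1).measurable (continuous_truncExp j j).measurable
      (truncExp_mem_Icc hj0 j)).bdd_mul ((hψ n).1.comp (hW n)).aestronglyMeasurable (c := 1)
      (ae_of_all _ fun ω => by
        rw [Real.norm_of_nonneg ((hψ n).2 _).1]; exact ((hψ n).2 _).2)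
  · dsimp only
    rw [mul_comm]
    refine mul_le_mul_of_nonneg_right ?_ (truncExp_nonneg hj0 _ _)
    rcases le_or_gt z (U n ω) with h | h
    · rw [hreject n ω h]
      exact ramp_le_one _ _
    · rw [ramp_of_nonpos _ (by linarith)]
      exact ((hψ n).2 _).1

/-- The asymptotic level of a one-sided test based on an asymptotically normal statistic. -/
theorem tendsto_measureReal_le_of_tendstoInDistribution {Ω : Type*} [MeasurableSpace Ω]
    {P : Measure Ω} [IsProbabilityMeasure P] {U : ℕ → Ω → ℝ}
    (hU : TendstoInDistribution U atTop id (fun _ => P) (gaussianReal 0 1)) (z : ℝ) :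
    Tendsto (fun n => P.real {ω | z ≤ U n ω}) atTop (𝓝 (1 - stdNormalCDF z)) := by
  have := nullSingletonClass_gaussianReal (μ := 0) (one_ne_zero : (1 : NNReal) ≠ 0)
  have hlim := ProbabilityMeasure.tendsto_measure_of_null_frontier_of_tendsto' hU.tendsto
    (E := Set.Ici z) (by simp)
  simp only [ProbabilityMeasure.coe_mk, Measure.map_id] at hlim
  have h2 := (ENNReal.tendsto_toReal (measure_ne_top _ _)).comp hlim
  have h3 := measureReal_Ioi_gaussianReal 0 z
  rw [sub_zero, measureReal_congr Ioi_ae_eq_Ici] at h3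
  rw [← h3]
  refine h2.congr fun n => ?_
  rw [Function.comp, Measure.map_apply_of_aemeasurable (hU.forall_aemeasurable n) measurableSet_Ici]
  rfl

/-! ### Calculus of `o_P` and `O_P`. -/

section StochasticOrders

variable {Ω E : Type*} [MeasurableSpace Ω] [NormedAddCommGroup E] {P : Measure Ω}

theorem IsLittleOP.add {U V : ℕ → Ω → ℝ} (hU : IsLittleOP P U) (hV : IsLittleOP P V) :
    IsLittleOP P (fun n ω => U n ω + V n ω) := by
  refine tendstoInMeasure_iff_norm.2 fun ε hε => ?_
  have h := (tendstoInMeasure_iff_norm.1 hU (ε / 2) (half_pos hε)).add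
    (tendstoInMeasure_iff_norm.1 hV (ε / 2) (half_pos hε))
  rw [add_zero] at h
  refine tendsto_of_tendsto_of_tendsto_of_le_of_le tendsto_const_nhds h (fun _ => zero_le)
    fun n => (measure_mono fun ω hω => ?_).trans (measure_union_le _ _)
  simp only [Set.mem_ofPred_eq, Set.mem_union, sub_zero] at hω ⊢
  by_contra! hlt
  linarith [norm_add_le (U n ω) (V n ω)]

theorem IsLittleOP.congr' {U V : ℕ → Ω → ℝ} (hU : IsLittleOP P U)
    (h : ∀ᶠ n in atTop, U n =ᵐ[P] V n) : IsLittleOP P V :=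
  TendstoInMeasure.congr' h (EventuallyEq.refl _ _) hU

theorem IsBigOP.add {U V : ℕ → Ω → E} (hU : IsBigOP P U) (hV : IsBigOP P V) :
    IsBigOP P (fun n ω => U n ω + V n ω) := by
  intro δ hδ
  obtain ⟨M, hM⟩ := hU (δ / 2) (half_pos hδ)
  obtain ⟨N, hN⟩ := hV (δ / 2) (half_pos hδ)
  refine ⟨M + N, ?_⟩
  filter_upwards [hM, hN] with n h1 h2
  calc P {ω | M + N < ‖U n ω + V n ω‖} ≤ P ({ω | M < ‖U n ω‖} ∪ {ω | N < ‖V n ω‖}) :=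
        measure_mono fun ω hω => by
          simp only [Set.mem_ofPred_eq, Set.mem_union] at hω ⊢
          by_contra! hlt
          linarith [norm_add_le (U n ω) (V n ω)]
    _ ≤ ENNReal.ofReal (δ / 2) + ENNReal.ofReal (δ / 2) :=
        (measure_union_le _ _).trans (add_le_add h1 h2)
    _ = ENNReal.ofReal δ := by rw [← ENNReal.ofReal_add (by positivity) (by positivity), add_halves]

theorem IsBigOP.of_norm_eq {F : Type*} [NormedAddCommGroup F] {U : ℕ → Ω → E} {V : ℕ → Ω → F}
    (hU : IsBigOP P U) (h : ∀ n ω, ‖V n ω‖ = ‖U n ω‖) : IsBigOP P V := by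
  simpa only [IsBigOP, h] using hU

theorem IsBigOP.div_of_tendstoInMeasure {U V : ℕ → Ω → ℝ} {c : ℝ} (hU : IsBigOP P U)
    (hV : TendstoInMeasure P V atTop fun _ => c) (hc : c ≠ 0) :
    IsBigOP P (fun n ω => U n ω / V n ω) := by
  intro δ hδ
  obtain ⟨M, hM⟩ := hU (δ / 2) (half_pos hδ)
  have hc' : 0 < |c| / 2 := half_pos (abs_pos.2 hc)
  refine ⟨|M| / (|c| / 2), ?_⟩
  filter_upwards [hM, (tendstoInMeasure_iff_norm.1 hV (|c| / 2) hc').eventually_le_const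
    -- Off an event of probability at most `δ / 2`, the denominator is at least `|c| / 2` in
    -- absolute value.
    (ENNReal.ofReal_pos.2 (half_pos hδ))] with n h1 h2
  calc P {ω | |M| / (|c| / 2) < ‖U n ω / V n ω‖}
      ≤ P ({ω | M < ‖U n ω‖} ∪ {ω | |c| / 2 ≤ ‖V n ω - c‖}) :=
        measure_mono fun ω hω => by
          simp only [Set.mem_ofPred_eq, Set.mem_union] at hω ⊢
          by_contra! hlt
          have h3 : |c| / 2 ≤ ‖V n ω‖ := by
            have := norm_sub_norm_le c (V n ω)
            rw [norm_sub_rev, Real.norm_eq_abs c] at this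
            linarith [hlt.2]
          refine hω.not_ge ?_
          rw [norm_div]
          exact div_le_div₀ (abs_nonneg _) (hlt.1.trans (le_abs_self M)) hc' h3
    _ ≤ ENNReal.ofReal (δ / 2) + ENNReal.ofReal (δ / 2) :=
        (measure_union_le _ _).trans (add_le_add h1 h2)
    _ = ENNReal.ofReal δ := by rw [← ENNReal.ofReal_add (by positivity) (by positivity), add_halves]

theorem IsSqrtConsistent.tendstoInMeasure {ℓ p : ℕ} {φ : ℕ → Ω → Param ℓ p} {φ₀ : Param ℓ p}
    (h : IsSqrtConsistent P φ φ₀) : TendstoInMeasure P φ atTop fun _ => φ₀ := by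
  refine tendstoInMeasure_iff_norm.2 fun ε hε => ?_
  refine ENNReal.tendsto_nhds_zero.2 fun δ hδ => ?_
  obtain ⟨r, hr, hrδ⟩ : ∃ r : ℝ, 0 < r ∧ ENNReal.ofReal r ≤ δ := by
    rcases eq_or_ne δ ⊤ with rfl | hδt
    · exact ⟨1, one_pos, le_top⟩
    · exact ⟨δ.toReal, ENNReal.toReal_pos hδ.ne' hδt, (ENNReal.ofReal_toReal hδt).le⟩
  obtain ⟨M, hM⟩ := h r hr
  have hs : Tendsto (fun n : ℕ => Real.sqrt n * ε) atTop atTop :=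
    (Real.tendsto_sqrt_atTop.comp tendsto_natCast_atTop_atTop).atTop_mul_const hε
  filter_upwards [hM, hs.eventually_gt_atTop M] with n h1 h2
  refine (measure_mono fun ω hω => ?_).trans (h1.trans hrδ)
  simp only [Set.mem_ofPred_eq] at hω ⊢
  rw [norm_smul, Real.norm_of_nonneg (Real.sqrt_nonneg _)]
  exact h2.trans_le (mul_le_mul_of_nonneg_left hω (Real.sqrt_nonneg _))

theorem MeasureTheory.TendstoInMeasure.comp_continuousAt {F G : Type*} [PseudoMetricSpace F]
    [PseudoMetricSpace G] {φ : ℕ → Ω → F} {a : F} (h : TendstoInMeasure P φ atTop fun _ => a)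
    {g : F → G} (hg : ContinuousAt g a) :
    TendstoInMeasure P (fun n ω => g (φ n ω)) atTop fun _ => g a := by
  refine tendstoInMeasure_iff_dist.2 fun ε hε => ?_
  obtain ⟨η, hη, hη'⟩ := Metric.continuousAt_iff.1 hg ε hε
  refine tendsto_of_tendsto_of_tendsto_of_le_of_le tendsto_const_nhds
    (tendstoInMeasure_iff_dist.1 h η hη) (fun _ => zero_le) fun n => measure_mono fun ω hω => ?_
  simp only [Set.mem_ofPred_eq] at hω ⊢
  by_contra! hlt
  exact hω.not_gt (hη' hlt)

end StochasticOrders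

/-! ### The modified estimate and the joint limit law. -/

theorem single_eq_smul_single_one {ι : Type*} [DecidableEq ι] (κ : ι) (r : ℝ) :
    (EuclideanSpace.single κ r : EuclideanSpace ℝ ι) = r • EuclideanSpace.single κ 1 := by
  ext i
  by_cases hi : i = κ <;> simp [hi]

theorem fderiv_modifiedEstimate_sub {ℓ p : ℕ} (F : Param ℓ p → ℝ) (φ : Param ℓ p)
    (κ : Fin ℓ ⊕ Fin p) (D : ℝ) (h : partialAt F φ κ ≠ 0) :
    fderiv ℝ F φ (modifiedEstimate F φ κ D - φ) = D := by
  rw [modifiedEstimate, add_sub_cancel_left, single_eq_smul_single_one, map_smul, smul_eq_mul]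
  exact div_mul_cancel₀ _ h

/-- The modified estimate is `√n`-consistent. -/
theorem isSqrtConsistent_modifiedEstimate {Ω : Type*} [MeasurableSpace Ω] {P : Measure Ω}
    {ℓ p : ℕ} {φhat : ℕ → Ω → Param ℓ p} {φ₀ : Param ℓ p} (hφ : IsSqrtConsistent P φhat φ₀)
    {D : ℕ → Ω → ℝ} (hD : IsBigOP P D) {F : ℕ → Ω → Param ℓ p → ℝ} {κ : ℕ → Fin ℓ ⊕ Fin p} {c : ℝ}
    (hc : c ≠ 0)
    (hC : TendstoInMeasure P (fun (n : ℕ) ω => 1 / Real.sqrt n * partialAt (F n ω) (φhat n ω) (κ n))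
      atTop fun _ => c) :
    IsSqrtConsistent P (fun n ω => modifiedEstimate (F n ω) (φhat n ω) (κ n) (D n ω)) φ₀ := by
  -- This vector is the correction multiplied by `√n`: the factor is absorbed into the normalized
  -- gradient in the denominator.
  have h1 : IsBigOP P fun n ω => (EuclideanSpace.single (κ n)
      (D n ω / (1 / Real.sqrt n * partialAt (F n ω) (φhat n ω) (κ n))) : Param ℓ p) :=
    (hD.div_of_tendstoInMeasure hC hc).of_norm_eq fun n ω => by simp
  have h2 := IsBigOP.add hφ h1
  unfold IsSqrtConsistent
  convert! h2 using 3 with n ω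
  ext i
  by_cases hi : i = κ n
  · simp [modifiedEstimate, hi, div_eq_mul_inv]
    ring
  · simp [modifiedEstimate, hi]

/-- Joint limit law of the studentized statistic and of the log-likelihood ratio. -/
theorem LAN.tendstoInDistribution_prodMk {Ω : Type*} [MeasurableSpace Ω] {P : Measure Ω}
    [IsProbabilityMeasure P] {Λ Vn : ℕ → Ω → ℝ} {τ : ℝ} (h : LAN P Λ Vn τ)
    (hΛ : ∀ n, AEMeasurable (Λ n) P) {V' τ' : ℕ → Ω → ℝ} (hV' : ∀ n, AEMeasurable (V' n) P)
    (hτ' : ∀ n, AEMeasurable (τ' n) P) (hV : IsLittleOP P fun n ω => V' n ω - Vn n ω)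
    (hτ : TendstoInMeasure P τ' atTop fun _ => τ) :
    TendstoInDistribution (fun n ω => (V' n ω / τ' n ω, Λ n ω)) atTop
      (fun x => (x, τ * x - τ ^ 2 / 2)) (fun _ => P) (gaussianReal 0 1) := by
  have hpos := h.pos
  have hlaw : (gaussianReal 0 1).map (fun x => τ * x) =
      (gaussianReal 0 (Real.toNNReal (τ ^ 2))).map id := by
    rw [gaussianReal_map_const_mul, Measure.map_id, mul_zero, mul_one]
    congr 1
    ext
    simp [sq_nonneg]
  have hclt : TendstoInDistribution Vn atTop (fun x : ℝ => τ * x) (fun _ => P)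
      (gaussianReal 0 1) := by
    refine ⟨h.clt.forall_aemeasurable, by fun_prop, ?_⟩
    convert! h.clt.tendsto using 1
    exact congrArg _ (Subtype.ext hlaw)
  have hVm := h.clt.forall_aemeasurable
  -- Slutsky is applied with `τ'⁻¹` instead of `τ'`, so that the final map is polynomial and
  -- continuous everywhere.
  have h1 := hclt.prodMk_of_tendstoInMeasure_const _ _ _
    (hτ.comp_continuousAt (continuousAt_inv₀ hpos.ne')) (fun n => (hτ' n).inv)
  have h2 := h1.prodMk_of_tendstoInMeasure_const _ _ _ hV (fun n => (hV' n).sub (hVm n))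
  have h3 := h2.prodMk_of_tendstoInMeasure_const _ _ _ h.expansion
    (fun n => (hΛ n).sub ((hVm n).sub_const _))
  have h4 := h3.continuous_comp (g := fun x : ((ℝ × ℝ) × ℝ) × ℝ =>
    ((x.1.1.1 + x.1.2) * x.1.1.2, x.1.1.1 - τ ^ 2 / 2 + x.2)) (by fun_prop)
  convert! h4 using 1
  · ext n ω <;> simp [div_eq_mul_inv]
  · ext x
    · simp only [Function.comp]
      field_simp
      simp
    · simp [Function.comp]

/-! ### Measurability and the main theorem. -/

theorem measurable_pathOf {Ω : Type*} [MeasurableSpace Ω] {d : ℕ} {Y : ℤ → Ω → ℝ}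
    {X : ℤ → Ω → Fin d → ℝ} (hY : ∀ i, Measurable (Y i)) (hX : ∀ i, Measurable (X i)) :
    Measurable (pathOf Y X) :=
  measurable_pi_lambda _ fun i => (hY i).prodMk (hX i)

theorem measurable_modifiedEstimate {𝒲 : Type*} [MeasurableSpace 𝒲] {ℓ p : ℕ}
    {F : 𝒲 → Param ℓ p → ℝ} {φ : 𝒲 → Param ℓ p} {κ : Fin ℓ ⊕ Fin p} {D : 𝒲 → ℝ}
    (hφ : Measurable φ) (hD : Measurable D) (hF : Measurable fun w => partialAt (F w) (φ w) κ) :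
    Measurable fun w => modifiedEstimate (F w) (φ w) κ (D w) := by
  simp only [modifiedEstimate]
  refine hφ.add ?_
  simp only [single_eq_smul_single_one κ (D _ / _)]
  exact (hD.div hF).smul_const _

theorem theorem1
    -- the observed process, its null law and its laws under the alternatives
    {Ω : Type*} [MeasurableSpace Ω] (P0 : Measure Ω) [IsProbabilityMeasure P0]
    (P1 : ℕ → Measure Ω) [∀ n, IsProbabilityMeasure (P1 n)]
    {d : ℕ} (s q : ℕ) (Y : ℤ → Ω → ℝ) (X : ℤ → Ω → Fin d → ℝ)
    (hY : ∀ i, Measurable (Y i)) (hX : ∀ i, Measurable (X i))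
    -- the parametric family and the true parameter
    {ℓ p : ℕ} (Θ₁ : Set (EuclideanSpace ℝ (Fin ℓ))) (Θ₂ : Set (EuclideanSpace ℝ (Fin p)))
    (hΘ₁ : (interior Θ₁).Nonempty) (hΘ₂ : (interior Θ₂).Nonempty)
    (m : EuclideanSpace ℝ (Fin ℓ) → Regressor d s q → ℝ)
    (σ : EuclideanSpace ℝ (Fin p) → Regressor d s q → ℝ) (hσ : ∀ θ ∈ Θ₂, ∀ z, 0 < σ θ z)
    (ρ₀ : EuclideanSpace ℝ (Fin ℓ)) (hρ₀ : ρ₀ ∈ Θ₁)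
    (θ₀ : EuclideanSpace ℝ (Fin p)) (hθ₀ : θ₀ ∈ Θ₂)
    (φ₀ : Param ℓ p) (hφ₀ : φ₀ = joinParam ρ₀ θ₀)
    -- the null hypothesis and the local alternatives
    (G S : Regressor d s q → ℝ) (f : ℝ → ℝ) (hf : Measurable f) (hf0 : ∀ x, 0 ≤ f x)
    (hH0 : FollowsModel s q Y X f (m ρ₀) (σ θ₀) P0)
    (hH1 : ∀ n : ℕ, 1 ≤ n → FollowsModel s q Y X f
      (fun z => m ρ₀ z + G z / Real.sqrt n) (fun z => σ θ₀ z + S z / Real.sqrt n) (P1 n))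
    -- the sample of size `n` and its densities under the two hypotheses
    {𝒲 : ℕ → Type*} [∀ n, MeasurableSpace (𝒲 n)] (obs : ∀ n, Trajectory d → 𝒲 n)
    (hobs : ∀ n, Measurable (obs n))
    (W : ∀ n, Ω → 𝒲 n) (hW : ∀ n ω, W n ω = obs n (pathOf Y X ω))
    (μ : ∀ n, Measure (𝒲 n)) (f0 f1 : ∀ n, 𝒲 n → ℝ)
    (hf0n : ∀ n : ℕ, 1 ≤ n → HasDensity P0 (W n) (μ n) (f0 n))
    (hf1n : ∀ n : ℕ, 1 ≤ n → HasDensity (P1 n) (W n) (μ n) (f1 n))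
    -- local asymptotic normality at `φ₀`, with central sequence `V n φ₀` and standard deviation `τ φ₀`
    (V : ∀ n, Param ℓ p → 𝒲 n → ℝ) (hV : ∀ n, Measurable (Function.uncurry (V n)))
    (τ : Param ℓ p → ℝ) (hτ : Measurable τ) (hτc : ContinuousAt τ φ₀)
    (hLAN : LAN P0 (fun n ω => Real.log (f1 n (W n ω) / f0 n (W n ω)))
      (fun n ω => V n φ₀ (W n ω)) (τ φ₀))
    -- (E.1)
    (φhat : ∀ n, 𝒲 n → Param ℓ p) (hφhat : ∀ n, Measurable (φhat n))
    (hcons : IsSqrtConsistent P0 (fun n ω => φhat n (W n ω)) φ₀)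
    (D : ∀ n, 𝒲 n → ℝ) (hD : ∀ n, Measurable (D n))
    (hDbdd : IsBigOP P0 (fun n ω => D n (W n ω)))
    (hE1 : IsLittleOP P0 (fun n ω =>
      V n (φhat n (W n ω)) (W n ω) - (V n φ₀ (W n ω) - D n (W n ω))))
    -- the modified coordinate, a coordinate of `ρ` in case (C.1) and of `θ` in case (C.2):
    -- the partial derivative exists, does not vanish, and converges after division by `√n`
    (κ : ℕ → Fin ℓ ⊕ Fin p)
    (hdiff : ∀ n : ℕ, 1 ≤ n → ∀ᵐ ω ∂P0,
      DifferentiableAt ℝ (fun φ => V n φ (W n ω)) (φhat n (W n ω)))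
    (hpmeas : ∀ n, Measurable (fun w => partialAt (fun φ => V n φ w) (φhat n w) (κ n)))
    (hgrad : ∀ n : ℕ, 1 ≤ n → ∀ᵐ ω ∂P0,
      partialAt (fun φ => V n φ (W n ω)) (φhat n (W n ω)) (κ n) ≠ 0)
    (c : ℝ) (hc : c ≠ 0)
    (hC : TendstoInMeasure P0
      (fun (n : ℕ) ω => (1 / Real.sqrt n) *
        partialAt (fun φ => V n φ (W n ω)) (φhat n (W n ω)) (κ n)) atTop (fun _ => c))
    -- the modified estimate, which lies on the tangent space up to `o_P(1)`
    (φbar : ∀ n, 𝒲 n → Param ℓ p)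
    (hφbar : ∀ n w, φbar n w = modifiedEstimate (fun φ => V n φ w) (φhat n w) (κ n) (D n w))
    (htangent : IsLittleOP P0 (fun n ω =>
      tangentDefect (fun φ => V n φ (W n ω)) (φhat n (W n ω)) (φbar n (W n ω))))
    -- the level and the test with `φ₀` replaced by the modified estimate
    (α : ℝ) (hα : α ∈ Set.Ioo (0 : ℝ) 1)
    (Tbar : ∀ n, 𝒲 n → ℝ)
    (hTbar : ∀ n w, Tbar n w = npTest α (V n (φbar n w) w) (τ (φbar n w))) :
    -- the asymptotic power under the alternatives is `1 - Φ(Z(α) - τ)`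
    Tendsto (fun n => rejectionProb (P1 n) (W n) (Tbar n)) atTop
      (𝓝 (1 - stdNormalCDF (normalQuantile α - τ φ₀))) ∧
    -- it is also `1 - Φ(Z(α) - τ(φbar_n)) + o_P(1)`, under the alternatives
    (∀ δ : ℝ, 0 < δ → Tendsto (fun n => P1 n {ω | δ ≤
      |rejectionProb (P1 n) (W n) (Tbar n) -
        (1 - stdNormalCDF (normalQuantile α - τ (φbar n (W n ω))))|}) atTop (𝓝 0)) ∧
    -- the test is asymptotically optimal
    IsAsymptoticallyOptimal P0 P1 W α Tbar := by
  have hWm : ∀ n, Measurable (W n) := fun n => by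
    rw [funext (hW n)]
    exact (hobs n).comp (measurable_pathOf hY hX)
  have hφm : ∀ n, Measurable (φbar n) := fun n => by
    rw [funext (hφbar n)]
    exact measurable_modifiedEstimate (hφhat n) (hD n) (hpmeas n)
  have hVm : ∀ n, Measurable fun w => V n (φbar n w) w := fun n =>
    (hV n).comp ((hφm n).prodMk measurable_id)
  have hTm : ∀ n, Measurable fun w => τ (φbar n w) := fun n => hτ.comp (hφm n)
  have hpos := hLAN.pos
  set z := normalQuantile α with hz
  have hzα : 1 - stdNormalCDF z = α := by rw [stdNormalCDF_normalQuantile hα]; ring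
  -- the modified estimate is consistent, and may replace `φ₀` in the central sequence
  have hφlim : TendstoInMeasure P0 (fun n ω => φbar n (W n ω)) atTop fun _ => φ₀ := by
    simp_rw [hφbar]
    exact (isSqrtConsistent_modifiedEstimate hcons hDbdd hc hC).tendstoInMeasure
  have hVlim : IsLittleOP P0 fun n ω =>
      V n (φbar n (W n ω)) (W n ω) - V n φ₀ (W n ω) := by
    -- The `D` from the tangent step and the `-D` from (E.1) cancel in this sum.
    refine (htangent.add hE1).congr' ?_
    filter_upwards [eventually_ge_atTop 1] with n hn
    filter_upwards [hgrad n hn] with ω hω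
    have := fderiv_modifiedEstimate_sub _ _ _ (D n (W n ω)) hω
    rw [tangentDefect, hφbar, this]
    ring
  -- the joint limit law
  let Λ : ℕ → Ω → ℝ := fun n =>
    if 1 ≤ n then fun ω => Real.log (f1 n (W n ω) / f0 n (W n ω)) else 0
  have hL : ∀ n : ℕ, 1 ≤ n → IsLogLikelihoodRatio P0 (P1 n) (W n) (Λ n) := fun n hn => by
    simp only [Λ, if_pos hn]
    exact (hf0n n hn).isLogLikelihoodRatio (hWm n) (hf1n n hn)
  have hΛm : ∀ n, Measurable (Λ n) := fun n => by
    by_cases hn : 1 ≤ n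
    · exact (hL n hn).measurable
    · simp only [Λ, if_neg hn]
      exact measurable_zero
  have hLANΛ : LAN P0 Λ (fun n ω => V n φ₀ (W n ω)) (τ φ₀) :=
    ⟨hLAN.pos, hLAN.clt, hLAN.expansion.congr' (by
      filter_upwards [eventually_ge_atTop 1] with n hn
      simp only [Λ, if_pos hn]
      rfl)⟩
  have hU := hLANΛ.tendstoInDistribution_prodMk (fun n => (hΛm n).aemeasurable)
    (V' := fun n ω => V n (φbar n (W n ω)) (W n ω)) (τ' := fun n ω => τ (φbar n (W n ω)))
    (fun n => ((hVm n).comp (hWm n)).aemeasurable) (fun n => ((hTm n).comp (hWm n)).aemeasurable)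
    hVlim (hφlim.comp_continuousAt hτc)
  -- the level and the power of the test
  have htest : ∀ n, IsTest (Tbar n) := fun n => by
    rw [funext (hTbar n)]
    exact IsTest.indicator (((hVm n).div (hTm n)) measurableSet_Ici)
  have hlevel : Tendsto (fun n => rejectionProb P0 (W n) (Tbar n)) atTop (𝓝 α) := by
    have h := tendsto_measureReal_le_of_tendstoInDistribution
      (hU.continuous_comp continuous_fst) z
    rw [hzα] at h
    refine h.congr fun n => ?_
    rw [funext (hTbar n)]
    exact (rejectionProb_indicator P0 (hWm n) (((hVm n).div (hTm n)) measurableSet_Ici)).symm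
  have hupper : ∀ ψ : ∀ n, 𝒲 n → ℝ, (∀ n, IsTest (ψ n)) →
      (∀ δ : ℝ, 0 < δ → ∀ᶠ n in atTop, rejectionProb P0 (W n) (ψ n) ≤ α + δ) →
      ∀ δ : ℝ, 0 < δ → ∀ᶠ n in atTop,
        rejectionProb (P1 n) (W n) (ψ n) ≤ 1 - stdNormalCDF (z - τ φ₀) + δ := by
    intro ψ hψ hle δ hδ
    exact eventually_rejectionProb_le hWm hpos hL hU hψ (by rwa [hzα]) hδ
  have hlower : ∀ δ : ℝ, 0 < δ → ∀ᶠ n in atTop,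
      1 - stdNormalCDF (z - τ φ₀) - δ ≤ rejectionProb (P1 n) (W n) (Tbar n) := by
    intro δ hδ
    refine eventually_le_rejectionProb hWm hpos hL hU htest (fun n ω h => ?_) hδ
    rw [hTbar, npTest, Set.indicator_of_mem]
    exact h
  have hpower : Tendsto (fun n => rejectionProb (P1 n) (W n) (Tbar n)) atTop
      (𝓝 (1 - stdNormalCDF (z - τ φ₀))) := by
    refine Metric.tendsto_nhds.2 fun δ hδ => ?_
    -- The modified test has asymptotic level `α`, so the bound on all competitors applies to it
    -- too.
    filter_upwards [hlower (δ / 2) (half_pos hδ), hupper Tbar htest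
      (fun η hη => hlevel.eventually_le_const (by linarith)) (δ / 2) (half_pos hδ)] with n h1 h2
    rw [Real.dist_eq, abs_lt]
    constructor <;> linarith
  refine ⟨hpower, fun δ hδ => ?_, htest, hlevel, fun ψ hψ hle δ hδ => ?_⟩
  · -- by contiguity, the estimated power converges under the alternatives
    have hcdf : Measurable stdNormalCDF := continuous_stdNormalCDF.measurable
    have hlim : TendstoInMeasure P0 (fun n ω => stdNormalCDF (z - τ (φbar n (W n ω)))) atTop
        fun _ => stdNormalCDF (z - τ φ₀) :=
      hφlim.comp_continuousAt (g := fun φ => stdNormalCDF (z - τ φ))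
        (continuous_stdNormalCDF.continuousAt.comp (continuousAt_const.sub hτc))
    have hcont := tendsto_measure_zero_of_contiguous hWm hpos hL hU
      (A := fun n => {w | δ / 2 ≤ ‖stdNormalCDF (z - τ (φbar n w)) - stdNormalCDF (z - τ φ₀)‖})
      (fun n => measurableSet_le measurable_const
        ((hcdf.comp (measurable_const.sub (hTm n))).sub_const _).norm)
      (tendstoInMeasure_iff_norm.1 hlim (δ / 2) (half_pos hδ))
    refine tendsto_of_tendsto_of_tendsto_of_le_of_le' tendsto_const_nhds hcont
      (Eventually.of_forall fun _ => zero_le) ?_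
    filter_upwards [Metric.tendsto_nhds.1 hpower (δ / 2) (half_pos hδ)] with n hn
    refine measure_mono fun ω hω => ?_
    simp only [Set.mem_ofPred_eq, Set.mem_preimage, Real.norm_eq_abs, Real.dist_eq] at hω hn ⊢
    by_contra! hlt
    rw [abs_lt] at hn hlt
    refine hω.not_gt (abs_lt.2 ⟨?_, ?_⟩) <;> linarith [hn.1, hn.2, hlt.1, hlt.2]
  · filter_upwards [hupper ψ hψ hle (δ / 2) (half_pos hδ), hlower (δ / 2) (half_pos hδ)]
      with n h1 h2
    linarith
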